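/- Fix effective enumerations of $\mathbb Q$ and of the nonempty bounded open intervals $I_0,I_1,\dots$ of $\mathbb R$ with rational endpoints. An index is (the Gödel number of) a program. - An index of an open set $U\subseteq\mathbb R$ that is $\Sigma^0_1$ is an index of the set $\{i: I_i\subseteq U\}$ as a c.e. set. - A name of $x\in\mathbb R$ is a sequence $(q_n)$ of rationals with $\lim_n q_n=x$ and $|q_n-q_{n+1}|<2^{-n}$ for all $n$; $x$ is computable if it has a computable name, and an index of $x$ is an index of such a name. A real $x$ is left-c.e. if its left Dedekind cut $\{q\in\mathbb Q:q<x\}$ is c.e. - A function $f:\mathbb R\to\mathbb R$ is computable, with index $c$, if $c$ is an index of a Turing functional that maps every name of every $x\in\mathbb R$ to a name of $f(x)$. $C^c_K(\mathbb R)$ is the set of continuous, compactly supported, computable functions. - A name of a compact set $K\subseteq\mathbb R$ is an enumeration of all minimal finite covers of $K$ by rational open intervals (finite covers from which no interval can be omitted); an index of $K$ is an index of a computable name of $K$. - A modulus of convergence of a real sequence $(a_k)$ with limit $a$ is a function $g:\mathbb N\to\mathbb N$ such that $|a_k-a|<2^{-n}$ whenever $k\ge g(n)$. - A finite Borel measure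 $\mu$ on $\mathbb R$ is computable if $\mu(\mathbb R)$ is a computable real and $\mu(U)$ is left-c.e. uniformly in an index of $U\in\Sigma^0_1$, i.e. there is a partial computable function that maps every index of every $\Sigma^0_1$ set $U$ to an index of the left Dedekind cut of $\mu(U)$. A sequence $(\mu_n)$ is uniformly computable if each $\mu_n$ is computable, uniformly in $n$. - A sequence $(\mu_n)$ of finite Borel measures on $\mathbb R$ effectively vaguely converges to a finite Borel measure $\mu$ if $\lim_n\int f\,d\mu_n=\int f\,d\mu$ for every $f\in C^c_K(\mathbb R)$, and there is a partial computable function that maps every index of $f$ and every index of $\operatorname{supp} f$, for every $f\in C^c_K(\mathbb R)$, to an index of a modulus of convergence of $\left(\int f\,d\mu_n\right)_n$. **Proposition.** Let $(\mu_n)_{n\in\mathbb N}$ be a uniformly computable sequence of finite Borel measures on $\mathbb R$ that effectively vaguely converges to a finite Borel measure $\mu$. If $\mu(\mathbb R)$ is a computable real, then $\mu$ is a computable measure. -/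

import Mathlib

open Filter Topology MeasureTheory
open Nat.Partrec (Code)

namespace EffVague

/-! ## Turing functionals -/

/-- Programs for a machine with an oracle `ℕ → ℕ`: the programs `Nat.Partrec.Code` for partial
recursive functions, together with one instruction that queries the oracle. -/
inductive OracleCode : Type
  | zero : OracleCode
  | succ : OracleCode
  | left : OracleCode
  | right : OracleCode
  | oracle : OracleCode
  | pair : OracleCode → OracleCode → OracleCode
  | comp : OracleCode → OracleCode → OracleCode
  | prec : OracleCode → OracleCode → OracleCode
  | rfind' : OracleCode → OracleCode

namespace OracleCode

/-- The partial function `ℕ →. ℕ` computed by a program when the oracle is `ρ`. -/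
def eval (ρ : ℕ → ℕ) : OracleCode → ℕ →. ℕ
  | zero => pure 0
  | succ => Nat.succ
  | left => ↑fun n : ℕ => n.unpair.1
  | right => ↑fun n : ℕ => n.unpair.2
  | oracle => ↑ρ
  | pair cf cg => fun n => Nat.pair <$> eval ρ cf n <*> eval ρ cg n
  | comp cf cg => fun n => eval ρ cg n >>= eval ρ cf
  | prec cf cg =>
    Nat.unpaired fun a n =>
      n.rec (eval ρ cf a) fun y IH => do
        let i ← IH
        eval ρ cg (Nat.pair a (Nat.pair y i))
  | rfind' cf =>
    Nat.unpaired fun a m =>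
      (Nat.rfind fun n => (fun x => x = 0) <$> eval ρ cf (Nat.pair a (n + m))).map (· + m)

/-- The Gödel number of an oracle program. -/
def encodeCode : OracleCode → ℕ
  | zero => 0
  | succ => 1
  | left => 2
  | right => 3
  | oracle => 4
  | pair cf cg => 2 * (2 * Nat.pair (encodeCode cf) (encodeCode cg)) + 5
  | comp cf cg => 2 * (2 * Nat.pair (encodeCode cf) (encodeCode cg) + 1) + 5
  | prec cf cg => (2 * (2 * Nat.pair (encodeCode cf) (encodeCode cg)) + 1) + 5
  | rfind' cf => (2 * (2 * encodeCode cf + 1) + 1) + 5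

/-- The oracle program with a given Gödel number. -/
def ofNatCode : ℕ → OracleCode
  | 0 => zero
  | 1 => succ
  | 2 => left
  | 3 => right
  | 4 => oracle
  | n + 5 =>
    let m := n.div2.div2
    have hm : m < n + 5 := by
      simp only [m, Nat.div2_val]
      exact
        lt_of_le_of_lt (le_trans (Nat.div_le_self _ _) (Nat.div_le_self _ _))
          (Nat.succ_le_succ (Nat.le_add_right _ _))
    have _m1 : m.unpair.1 < n + 5 := lt_of_le_of_lt m.unpair_left_le hm
    have _m2 : m.unpair.2 < n + 5 := lt_of_le_of_lt m.unpair_right_le hm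
    match n.bodd, n.div2.bodd with
    | false, false => pair (ofNatCode m.unpair.1) (ofNatCode m.unpair.2)
    | false, true => comp (ofNatCode m.unpair.1) (ofNatCode m.unpair.2)
    | true, false => prec (ofNatCode m.unpair.1) (ofNatCode m.unpair.2)
    | true, true => rfind' (ofNatCode m)
  termination_by n => n
  decreasing_by all_goals first | exact hm | exact _m1 | exact _m2

theorem encode_ofNatCode : ∀ n, encodeCode (ofNatCode n) = n
  | 0 => by simp [ofNatCode, encodeCode]
  | 1 => by simp [ofNatCode, encodeCode]
  | 2 => by simp [ofNatCode, encodeCode]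
  | 3 => by simp [ofNatCode, encodeCode]
  | 4 => by simp [ofNatCode, encodeCode]
  | n + 5 => by
    let m := n.div2.div2
    have hm : m < n + 5 := by
      simp only [m, Nat.div2_val]
      exact
        lt_of_le_of_lt (le_trans (Nat.div_le_self _ _) (Nat.div_le_self _ _))
          (Nat.succ_le_succ (Nat.le_add_right _ _))
    have _m1 : m.unpair.1 < n + 5 := lt_of_le_of_lt m.unpair_left_le hm
    have _m2 : m.unpair.2 < n + 5 := lt_of_le_of_lt m.unpair_right_le hm
    have IH := encode_ofNatCode m
    have IH1 := encode_ofNatCode m.unpair.1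
    have IH2 := encode_ofNatCode m.unpair.2
    conv_rhs => rw [← Nat.bit_bodd_div2 n, ← Nat.bit_bodd_div2 n.div2]
    simp only [ofNatCode.eq_6]
    cases n.bodd <;> cases n.div2.bodd <;>
      simp [m, encodeCode, IH, IH1, IH2, Nat.bit_val]
  termination_by n => n
  decreasing_by all_goals first | exact hm | exact _m1 | exact _m2

/-- The Gödel numbering of oracle programs is a bijection with `ℕ`. -/
instance instDenumerable : Denumerable OracleCode :=
  Denumerable.mk'
    ⟨encodeCode, ofNatCode, fun c => by
        induction c <;> simp [encodeCode, ofNatCode, Nat.div2_val, *],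
      encode_ofNatCode⟩

end OracleCode

/-! ## Rational numbers and rational intervals -/

/-- The rational number `(a - b) / (d + 1)` coded by `⟨a, ⟨b, d⟩⟩`. -/
def rat (n : ℕ) : ℚ :=
  ((n.unpair.1 : ℚ) - (n.unpair.2.unpair.1 : ℚ)) / ((n.unpair.2.unpair.2 : ℚ) + 1)

/-- The positive rational number `(a + 1) / (d + 1)` coded by `⟨a, d⟩`. -/
def posRat (n : ℕ) : ℚ :=
  ((n.unpair.1 : ℚ) + 1) / ((n.unpair.2 : ℚ) + 1)

/-- The effective enumeration of the (bounded, nonempty) rational open intervals: the code `⟨a, b⟩`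
gives the left endpoint `rat a` and the length `posRat b`. -/
def ratInterval (i : ℕ) : Set ℝ :=
  Set.Ioo ((rat i.unpair.1 : ℚ) : ℝ) ((rat i.unpair.1 + posRat i.unpair.2 : ℚ) : ℝ)

theorem exists_rat_eq (q : ℚ) : ∃ n, rat n = q := by
  have hd : ((q.den - 1 : ℕ) : ℚ) + 1 = q.den := by
    have := q.pos
    exact_mod_cast (show q.den - 1 + 1 = q.den by omega)
  have hn : ((q.num.toNat : ℕ) : ℚ) - (((-q.num).toNat : ℕ) : ℚ) = q.num := by
    exact_mod_cast (show ((q.num.toNat : ℕ) : ℤ) - (((-q.num).toNat : ℕ) : ℤ) = q.num by omega)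
  refine ⟨Nat.pair q.num.toNat (Nat.pair (-q.num).toNat (q.den - 1)), ?_⟩
  simp only [rat, Nat.unpair_pair, hd, hn]
  exact Rat.num_div_den q

theorem exists_posRat_eq (q : ℚ) (hq : 0 < q) : ∃ n, posRat n = q := by
  have hd : ((q.den - 1 : ℕ) : ℚ) + 1 = q.den := by
    have := q.pos
    exact_mod_cast (show q.den - 1 + 1 = q.den by omega)
  have hn : (((q.num - 1).toNat : ℕ) : ℚ) + 1 = q.num := by
    have := Rat.num_pos.2 hq
    exact_mod_cast (show (((q.num - 1).toNat : ℕ) : ℤ) + 1 = q.num by omega)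
  refine ⟨Nat.pair (q.num - 1).toNat (q.den - 1), ?_⟩
  simp only [posRat, Nat.unpair_pair, hd, hn]
  exact Rat.num_div_den q

/-- Every nonempty bounded open interval with rational endpoints is enumerated. -/
theorem exists_ratInterval_eq (a b : ℚ) (hab : a < b) :
    ∃ i, ratInterval i = Set.Ioo (a : ℝ) (b : ℝ) := by
  obtain ⟨m, hm⟩ := exists_rat_eq a
  obtain ⟨n, hn⟩ := exists_posRat_eq (b - a) (sub_pos.2 hab)
  exact ⟨Nat.pair m n, by simp [ratInterval, hm, hn]⟩

/-! ## Names and indices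

An index is a program (a `Code`, or an `OracleCode` for a Turing functional); programs are
identified with natural numbers through their Gödel numbering. -/

/-- The program `e` computes the total function `p`. -/
def Computes {α : Type*} [Encodable α] (e : Code) (p : ℕ → α) : Prop :=
  ∀ n, Encodable.encode (p n) ∈ e.eval n

/-- `e` is an index of the c.e. set `S`: `S` is the domain of the partial function computed
by `e`. -/
def IndexesCE (e : Code) (S : Set ℕ) : Prop :=
  ∀ n, n ∈ S ↔ (e.eval n).Dom

/-- `U` is a `Σ⁰₁` set with index `e`: `U` is open and `e` is an index of `{i | I_i ⊆ U}`. -/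
def IndexesOpen (e : Code) (U : Set ℝ) : Prop :=
  IsOpen U ∧ IndexesCE e {i | ratInterval i ⊆ U}

/-- `ρ` is a (Cauchy) name of the real number `x`. -/
def IsRealName (ρ : ℕ → ℕ) (x : ℝ) : Prop :=
  Tendsto (fun n => ((rat (ρ n) : ℚ) : ℝ)) atTop (𝓝 x) ∧
    ∀ n, |rat (ρ n) - rat (ρ (n + 1))| < (1 / 2 : ℚ) ^ n

/-- `e` is an index of the computable real number `x`: it computes a name of `x`. -/
def IndexesReal (e : Code) (x : ℝ) : Prop :=
  ∃ ρ : ℕ → ℕ, Computes e ρ ∧ IsRealName ρ x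

/-- The real number `x` is computable. -/
def IsComputableReal (x : ℝ) : Prop :=
  ∃ e : Code, IndexesReal e x

/-- `e` is an index of the left Dedekind cut `{q ∈ ℚ | q < x}` as a c.e. set. -/
def IndexesLeftCut (e : Code) (x : ℝ) : Prop :=
  IndexesCE e {n | ((rat n : ℚ) : ℝ) < x}

/-- `c` is an index of the computable function `f : ℝ → ℝ`: it is a Turing functional that turns
every name of a real `x` into a name of `f x`. -/
def IndexesFunction (c : OracleCode) (f : ℝ → ℝ) : Prop :=
  ∀ (x : ℝ) (ρ : ℕ → ℕ), IsRealName ρ x →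
    ∃ σ : ℕ → ℕ, (∀ n, σ n ∈ c.eval ρ n) ∧ IsRealName σ (f x)

/-- `f` belongs to the set `C_K^c(ℝ)` of compactly supported computable functions. -/
def IsCompactlySupportedComputable (f : ℝ → ℝ) : Prop :=
  Continuous f ∧ HasCompactSupport f ∧ ∃ c : OracleCode, IndexesFunction c f

/-- The finite list of rational open intervals coded by `l` covers `K`. -/
def IsCover (l : List ℕ) (K : Set ℝ) : Prop :=
  K ⊆ ⋃ i ∈ l, ratInterval i

/-- The finite list of rational open intervals coded by `l` is a minimal cover of `K`: it covers `K`
and no interval can be left out. -/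
def IsMinimalCover (l : List ℕ) (K : Set ℝ) : Prop :=
  IsCover l K ∧ ∀ l' : List ℕ, l'.Sublist l → l' ≠ l → ¬ IsCover l' K

/-- `p` is a (minimal cover) name of the compact set `K`: it enumerates all minimal finite covers
of `K` by rational open intervals. -/
def IsCompactName (p : ℕ → List ℕ) (K : Set ℝ) : Prop :=
  Set.range p = {l | IsMinimalCover l K}

/-- `e` is an index of the computably compact set `K`: it computes a name of `K`. -/
def IndexesCompact (e : Code) (K : Set ℝ) : Prop :=
  IsCompact K ∧ ∃ p : ℕ → List ℕ, Computes e p ∧ IsCompactName p K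

/-- `g` is a modulus of convergence of the sequence `a` with limit `l`. -/
def IsModulus (g : ℕ → ℕ) (a : ℕ → ℝ) (l : ℝ) : Prop :=
  ∀ n k, g n ≤ k → |a k - l| < (1 / 2 : ℝ) ^ n

/-- `e` is an index of a modulus of convergence of the sequence `a` with limit `l`. -/
def IndexesModulus (e : Code) (a : ℕ → ℝ) (l : ℝ) : Prop :=
  ∃ g : ℕ → ℕ, Computes e g ∧ IsModulus g a l

/-! ## Computable measures and effective vague convergence -/

/-- The finite Borel measure `μ` is computable: `μ(ℝ)` is a computable real, and an index of the
left Dedekind cut of `μ(U)` can be computed from every index of every `Σ⁰₁` set `U`. -/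
def IsComputableMeasure (μ : FiniteMeasure ℝ) : Prop :=
  IsComputableReal (μ Set.univ : ℝ) ∧
    ∃ g : Code →. Code, Partrec g ∧
      ∀ (U : Set ℝ) (e : Code), IndexesOpen e U → ∃ d ∈ g e, IndexesLeftCut d (μ U : ℝ)

/-- The measures `μ n` are computable uniformly in `n`. -/
def IsUniformlyComputable (μ : ℕ → FiniteMeasure ℝ) : Prop :=
  (∃ h : ℕ → Code, Computable h ∧ ∀ n, IndexesReal (h n) (μ n Set.univ : ℝ)) ∧
    ∃ g : ℕ → Code →. Code, Partrec₂ g ∧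
      ∀ (n : ℕ) (U : Set ℝ) (e : Code), IndexesOpen e U →
        ∃ d ∈ g n e, IndexesLeftCut d (μ n U : ℝ)

/-- `μ n` effectively vaguely converges to `ν`: for every compactly supported computable `f` the
integrals converge, and an index of a modulus of convergence can be computed from an index of `f`
and an index of the support of `f`. -/
def EffectivelyVaguelyConverges (μ : ℕ → FiniteMeasure ℝ) (ν : FiniteMeasure ℝ) : Prop :=
  (∀ f : ℝ → ℝ, IsCompactlySupportedComputable f →
    Tendsto (fun n => ∫ x, f x ∂(μ n : Measure ℝ)) atTop (𝓝 (∫ x, f x ∂(ν : Measure ℝ)))) ∧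
  ∃ G : OracleCode → Code →. Code, Partrec₂ G ∧
    ∀ f : ℝ → ℝ, IsCompactlySupportedComputable f →
      ∀ (c : OracleCode) (k : Code), IndexesFunction c f → IndexesCompact k (tsupport f) →
        ∃ d ∈ G c k, IndexesModulus d (fun n => ∫ x, f x ∂(μ n : Measure ℝ))
          (∫ x, f x ∂(ν : Measure ℝ))

end EffVague

namespace EffVague

/-! ## Recursively enumerable predicates -/

section RE

variable {α β : Type*} [Primcodable α] [Primcodable β]

/-! The mass of the limit being given as computable, what has to be found is an algorithm for left
cuts. An open set's measure is the supremum of sums over finite pairwise disjoint families of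
rational intervals inside it (`lt_measureReal_iff`). It therefore suffices that the relation "r <
ν(I)", for r rational and I a rational interval, is c.e.; `exists_indexesLeftCut` then passes to
arbitrary open sets, uniformly in their indices.

For intervals, test the convergence on trapezoids f of slope one and height h = 1/(s+1) supported on
the closure of I. If J lies in I with margin h, then h·1_J ≤ f ≤ h·1_I. Suppose u < μ_n(J), where n
is beyond the modulus of f at precision m. Then hu < ∫f dμ_n < ∫f dν + 2^{-m} ≤ h ν(I) + 1/(m+1), so
ν(I) > u - (s+1)/(m+1). Only lower bounds on μ_n(J) occur, and these are c.e. Conversely, if r <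
ν(I), choose nested intervals K ⊂ J ⊂ I with r < u < ν(K). The trapezoid on J, together with plain
convergence, gives u < μ_n(J) for all large n, so the search succeeds
(`lt_measureReal_ratInterval_iff`).

To query the modulus, programs for f and for its support must be computed from (I, s). For f,
rational arithmetic is applied to each term of a name (`exists_indexesFunction_ratTent`). For the
support, minimality of a finite cover of a rational closed interval is decidable
(`exists_indexesCompact_ratIcc`). -/

theorem rePred_comp {p : β → Prop} {f : α → β} (hp : REPred p) (hf : Computable f) :
    REPred fun a => p (f a) :=
  Partrec.comp hp hf

theorem rePred_and {p q : α → Prop} (hp : REPred p) (hq : REPred q) :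
    REPred fun a => p a ∧ q a := by
  have h : Partrec fun a => (Part.assert (p a) fun _ => Part.some ()).bind
      fun _ => Part.assert (q a) fun _ => Part.some () :=
    Partrec.bind hp (Partrec.comp hq Computable.fst).to₂
  refine (Partrec.dom_re h).of_eq fun a => ?_
  simp [Part.assert]

/-- Every r.e. predicate is the halting predicate of a program. -/
theorem exists_code_dom_iff {p : α → Prop} (hp : REPred p) :
    ∃ c : Code, ∀ a, (c.eval (Encodable.encode a)).Dom ↔ p a := by
  obtain ⟨c, hc⟩ := Code.exists_code.1 hp
  refine ⟨c, fun a => ?_⟩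
  rw [hc]
  simp [Part.assert]

/-- An r.e. predicate is the union of an increasing sequence of uniformly decidable ones. -/
theorem exists_stage {p : α → Prop} (hp : REPred p) :
    ∃ r : α → ℕ → Bool, Primrec₂ r ∧ (∀ a m n, m ≤ n → r a m → r a n) ∧
      ∀ a, p a ↔ ∃ n, r a n := by
  obtain ⟨c, hc⟩ := exists_code_dom_iff hp
  refine ⟨fun a n => (Code.evaln n c (Encodable.encode a)).isSome, ?_, ?_, ?_⟩
  · exact Primrec.option_isSome.comp (Code.primrec_evaln.comp
      ((Primrec.snd.pair (Primrec.const c)).pair (Primrec.encode.comp Primrec.fst)))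
  · intro a m n hmn h
    obtain ⟨x, hx⟩ := Option.isSome_iff_exists.1 h
    exact Option.isSome_iff_exists.2 ⟨x, Code.evaln_mono hmn hx⟩
  · intro a
    rw [← hc, Part.dom_iff_mem]
    simp only [Code.evaln_complete, Option.isSome_iff_exists, Option.mem_def]
    exact exists_comm

/-- Dovetailing: one number codes both a candidate witness and a stage, so a single unbounded search
suffices. -/
theorem rePred_exists {p : α → β → Prop} (hp : REPred fun x : α × β => p x.1 x.2) :
    REPred fun a => ∃ b, p a b := by
  obtain ⟨r, hr, -, hpr⟩ := exists_stage hp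
  let f : α → ℕ → Option Unit := fun a n =>
    (Encodable.decode (α := β) n.unpair.1).bind fun b => cond (r (a, b) n.unpair.2) (some ()) none
  have hf : Computable₂ f := by
    refine Primrec₂.to_comp ?_
    refine Primrec.option_bind (Primrec.decode.comp (Primrec.fst.comp
      (Primrec.unpair.comp Primrec.snd))) ?_
    exact Primrec.cond (hr.comp ((Primrec.fst.comp Primrec.fst).pair Primrec.snd)
      (Primrec.snd.comp (Primrec.unpair.comp (Primrec.snd.comp Primrec.fst))))
      (Primrec.const _) (Primrec.const _)
  refine (Partrec.dom_re (Partrec.rfindOpt hf)).of_eq fun a => ?_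
  rw [Nat.rfindOpt_dom]
  constructor
  · rintro ⟨n, u, hu⟩
    obtain ⟨b, -, hb⟩ := Option.bind_eq_some_iff.1 hu
    refine ⟨b, (hpr (a, b)).2 ⟨n.unpair.2, ?_⟩⟩
    cases h : r (a, b) n.unpair.2
    · rw [h] at hb
      cases hb
    · rfl
  · rintro ⟨b, hb⟩
    obtain ⟨n, hn⟩ := (hpr (a, b)).1 hb
    exact ⟨Nat.pair (Encodable.encode b) n, (), by simp [f, hn]⟩

/-- Stages are monotone, so the finitely many semidecisions have all succeeded at the maximum of
their stages, and checking a list at a given stage is decidable. -/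
theorem rePred_forall_mem_list {p : α → β → Prop} (hp : REPred fun x : α × β => p x.1 x.2) :
    REPred fun x : α × List β => ∀ b ∈ x.2, p x.1 b := by
  obtain ⟨r, hr, hmono, hpr⟩ := exists_stage hp
  have hR : PrimrecRel fun (b : β) (y : α × ℕ) => r (y.1, b) y.2 = true :=
    Primrec.primrecPred ((hr.comp ((Primrec.fst.comp Primrec.snd).pair Primrec.fst)
      (Primrec.snd.comp Primrec.snd)).of_eq fun _ => Bool.decide_eq_true.symm)
  have h1 : PrimrecPred fun x : (α × List β) × ℕ => ∀ b ∈ x.1.2, r (x.1.1, b) x.2 = true :=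
    hR.forall_mem_list.comp (Primrec.snd.comp Primrec.fst)
      ((Primrec.fst.comp Primrec.fst).pair Primrec.snd)
  refine (rePred_exists (p := fun (x : α × List β) n => ∀ b ∈ x.2, r (x.1, b) n = true)
    h1.computablePred.to_re).of_eq fun ⟨a, l⟩ => ?_
  constructor
  · rintro ⟨n, hn⟩ b hb
    exact (hpr (a, b)).2 ⟨n, hn b hb⟩
  · intro h
    induction l with
    | nil => simp
    | cons b l ih =>
      obtain ⟨n, hn⟩ := ih fun b hb => h b (List.mem_cons_of_mem _ hb)
      obtain ⟨m, hm⟩ := (hpr (a, b)).1 (h b List.mem_cons_self)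
      refine ⟨max m n, fun c hc => ?_⟩
      rcases List.mem_cons.1 hc with rfl | hc
      · exact hmono _ _ _ (le_max_left _ _) hm
      · exact hmono _ _ _ (le_max_right _ _) (hn c hc)

/-- The `S_n^m` theorem for total functions: a computable function of two variables has
uniformly computable programs for its sections. -/
theorem exists_computes {γ : Type*} [Primcodable γ] {p : α → ℕ → γ} (hp : Computable₂ p) :
    ∃ k : α → Code, Computable k ∧ ∀ a, Computes (k a) (p a) := by
  obtain ⟨c, hc⟩ := Code.exists_code.1 hp
  refine ⟨fun a => Code.curry c (Encodable.encode a), ?_, fun a n => ?_⟩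
  · exact (Code.primrec₂_curry.comp (Primrec.const c) Primrec.encode).to_comp
  · rw [Code.eval_curry, hc]
    have : Nat.pair (Encodable.encode a) n = Encodable.encode (a, n) := rfl
    rw [this]
    simp only [Encodable.encodek]
    simp

/-- The `S_n^m` theorem for r.e. sets. -/
theorem exists_indexesCE {p : α → ℕ → Prop} (hp : REPred fun x : α × ℕ => p x.1 x.2) :
    ∃ k : α → Code, Computable k ∧ ∀ a, IndexesCE (k a) {n | p a n} := by
  obtain ⟨c, hc⟩ := exists_code_dom_iff hp
  refine ⟨fun a => Code.curry c (Encodable.encode a), ?_, fun a n => ?_⟩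
  · exact (Code.primrec₂_curry.comp (Primrec.const c) Primrec.encode).to_comp
  · rw [Code.eval_curry]
    exact (hc (a, n)).symm

end RE

/-! ## Oracle programs -/

namespace OracleCode

/-- An ordinary program, seen as an oracle program that makes no queries. -/
def ofCode : Code → OracleCode
  | .zero => zero
  | .succ => succ
  | .left => left
  | .right => right
  | .pair cf cg => pair (ofCode cf) (ofCode cg)
  | .comp cf cg => comp (ofCode cf) (ofCode cg)
  | .prec cf cg => prec (ofCode cf) (ofCode cg)
  | .rfind' cf => rfind' (ofCode cf)

theorem eval_ofCode (ρ : ℕ → ℕ) (c : Code) : eval ρ (ofCode c) = c.eval := by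
  induction c <;> simp_all [ofCode, eval, Code.eval] <;> rfl

/-- The oracle program computing a constant function. -/
def const : ℕ → OracleCode
  | 0 => zero
  | n + 1 => comp succ (const n)

theorem eval_const (ρ : ℕ → ℕ) (n m : ℕ) : eval ρ (const n) m = Part.some n := by
  induction n with
  | zero => rfl
  | succ n ih =>
    simp only [const, eval, ih]
    exact Part.bind_some n _

theorem primrec₂_comp : Primrec₂ comp := by
  have : Primrec₂ fun a b : OracleCode =>
      2 * (2 * Nat.pair (Encodable.encode a) (Encodable.encode b) + 1) + 5 :=
    Primrec.nat_add.comp (Primrec.nat_mul.comp (Primrec.const 2) (Primrec.nat_add.comp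
      (Primrec.nat_mul.comp (Primrec.const 2) (Primrec₂.natPair.comp
        (Primrec.encode.comp Primrec.fst) (Primrec.encode.comp Primrec.snd)))
      (Primrec.const 1))) (Primrec.const 5)
  exact Primrec.encode_iff.1 this

theorem primrec₂_pair : Primrec₂ pair := by
  have : Primrec₂ fun a b : OracleCode =>
      2 * (2 * Nat.pair (Encodable.encode a) (Encodable.encode b)) + 5 :=
    Primrec.nat_add.comp (Primrec.nat_mul.comp (Primrec.const 2)
      (Primrec.nat_mul.comp (Primrec.const 2) (Primrec₂.natPair.comp
        (Primrec.encode.comp Primrec.fst) (Primrec.encode.comp Primrec.snd))))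
      (Primrec.const 5)
  exact Primrec.encode_iff.1 this

theorem primrec_const : Primrec const := by
  refine (Primrec.nat_rec₁ zero (f := fun _ c => comp succ c)
    (primrec₂_comp.comp (Primrec.const succ) Primrec.snd)).of_eq fun n => ?_
  induction n with
  | zero => rfl
  | succ n ih => simp [const, ← ih]

/-- A computable operation on a parameter and the values of the oracle is carried out by an oracle
program that can be computed from the parameter. -/
theorem exists_eval_eq {α : Type*} [Primcodable α] {F : α → ℕ → ℕ} (hF : Computable₂ F) :
    ∃ c : α → OracleCode, Computable c ∧ ∀ a ρ n, F a (ρ n) ∈ (c a).eval ρ n := by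
  obtain ⟨e, he⟩ := Code.exists_code.1 hF
  -- The parameter is hardwired as a constant and paired with the oracle's answer before the
  -- ordinary program runs.
  refine ⟨fun a => comp (ofCode e) (pair (const (Encodable.encode a)) oracle), ?_, fun a ρ n => ?_⟩
  · exact (primrec₂_comp.comp (Primrec.const _) (primrec₂_pair.comp
      (primrec_const.comp Primrec.encode) (Primrec.const _))).to_comp
  · have : Nat.pair (Encodable.encode a) (ρ n) = Encodable.encode (a, ρ n) := rfl
    have h : (pair (const (Encodable.encode a)) oracle).eval ρ n =
        Part.some (Nat.pair (Encodable.encode a) (ρ n)) := by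
      simp [eval, eval_const, Seq.seq]
    refine Part.mem_bind (h ▸ Part.mem_some _) ?_
    rw [eval_ofCode, he, this]
    simp only [Encodable.encodek]
    simp

end OracleCode

/-! ## Arithmetic on codes of rational numbers -/

/-- Addition on codes of rational numbers. -/
def ratAdd (m n : ℕ) : ℕ :=
  Nat.pair (m.unpair.1 * (n.unpair.2.unpair.2 + 1) + n.unpair.1 * (m.unpair.2.unpair.2 + 1))
    (Nat.pair
      (m.unpair.2.unpair.1 * (n.unpair.2.unpair.2 + 1) +
        n.unpair.2.unpair.1 * (m.unpair.2.unpair.2 + 1))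
      ((m.unpair.2.unpair.2 + 1) * n.unpair.2.unpair.2 + m.unpair.2.unpair.2))

/-- Negation on codes of rational numbers. -/
def ratNeg (m : ℕ) : ℕ :=
  Nat.pair m.unpair.2.unpair.1 (Nat.pair m.unpair.1 m.unpair.2.unpair.2)

/-- Codes of nonnegative fractions. -/
def ratFrac (m n : ℕ) : ℕ :=
  Nat.pair m (Nat.pair 0 n)

/-- Minimum on codes of rational numbers. -/
def ratMin (m n : ℕ) : ℕ := if rat m ≤ rat n then m else n

/-- Maximum on codes of rational numbers. -/
def ratMax (m n : ℕ) : ℕ := if rat m ≤ rat n then n else m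

/-- A code of the right endpoint of an interval. -/
def rightEnd (i : ℕ) : ℕ :=
  ratAdd i.unpair.1 (ratFrac (i.unpair.2.unpair.1 + 1) i.unpair.2.unpair.2)

theorem rat_ratAdd (m n : ℕ) : rat (ratAdd m n) = rat m + rat n := by
  simp only [rat, ratAdd, Nat.unpair_pair]
  push_cast
  have h1 : ((m.unpair.2.unpair.2 : ℚ) + 1) ≠ 0 := by positivity
  have h2 : ((n.unpair.2.unpair.2 : ℚ) + 1) ≠ 0 := by positivity
  -- Codes store the denominator minus one, so the last component of the sum is the product of the
  -- denominators minus one.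
  have h3 : ((m.unpair.2.unpair.2 : ℚ) + 1) * n.unpair.2.unpair.2 + m.unpair.2.unpair.2 + 1 =
    ((m.unpair.2.unpair.2 : ℚ) + 1) * ((n.unpair.2.unpair.2 : ℚ) + 1) := by ring
  rw [h3]
  field_simp
  ring

theorem rat_ratNeg (m : ℕ) : rat (ratNeg m) = -rat m := by
  simp only [rat, ratNeg, Nat.unpair_pair]
  ring

theorem rat_ratFrac (m n : ℕ) : rat (ratFrac m n) = (m : ℚ) / (n + 1) := by
  simp [rat, ratFrac]

theorem rat_ratMin (m n : ℕ) : rat (ratMin m n) = min (rat m) (rat n) := by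
  unfold ratMin
  split_ifs with h
  · rw [min_eq_left h]
  · rw [min_eq_right (not_le.1 h).le]

theorem rat_ratMax (m n : ℕ) : rat (ratMax m n) = max (rat m) (rat n) := by
  unfold ratMax
  split_ifs with h
  · rw [max_eq_right h]
  · rw [max_eq_left (not_le.1 h).le]

theorem posRat_pos (n : ℕ) : 0 < posRat n := by
  unfold posRat
  positivity

theorem rat_rightEnd (i : ℕ) : rat (rightEnd i) = rat i.unpair.1 + posRat i.unpair.2 := by
  rw [rightEnd, rat_ratAdd, rat_ratFrac, posRat]
  push_cast
  rfl

theorem ratInterval_eq (i : ℕ) :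
    ratInterval i = Set.Ioo ((rat i.unpair.1 : ℚ) : ℝ) ((rat (rightEnd i) : ℚ) : ℝ) := by
  rw [rat_rightEnd, ratInterval]

theorem rat_left_lt_right (i : ℕ) : rat i.unpair.1 < rat (rightEnd i) := by
  rw [rat_rightEnd]
  linarith [posRat_pos i.unpair.2]

theorem primrec₂_ratFrac : Primrec₂ ratFrac :=
  Primrec₂.natPair.comp Primrec.fst (Primrec₂.natPair.comp (Primrec.const 0) Primrec.snd)

theorem primrec₂_ratAdd : Primrec₂ ratAdd := by
  have l : Primrec fun x : ℕ => x.unpair.1 := Primrec.fst.comp Primrec.unpair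
  have r : Primrec fun x : ℕ => x.unpair.2 := Primrec.snd.comp Primrec.unpair
  have b1 : Primrec fun x : ℕ × ℕ => x.1.unpair.1 := l.comp Primrec.fst
  have b2 : Primrec fun x : ℕ × ℕ => x.1.unpair.2.unpair.1 := l.comp (r.comp Primrec.fst)
  have b3 : Primrec fun x : ℕ × ℕ => x.1.unpair.2.unpair.2 := r.comp (r.comp Primrec.fst)
  have c1 : Primrec fun x : ℕ × ℕ => x.2.unpair.1 := l.comp Primrec.snd
  have c2 : Primrec fun x : ℕ × ℕ => x.2.unpair.2.unpair.1 := l.comp (r.comp Primrec.snd)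
  have c3 : Primrec fun x : ℕ × ℕ => x.2.unpair.2.unpair.2 := r.comp (r.comp Primrec.snd)
  have b3' := Primrec.succ.comp b3
  have c3' := Primrec.succ.comp c3
  exact Primrec₂.natPair.comp
    (Primrec.nat_add.comp (Primrec.nat_mul.comp b1 c3') (Primrec.nat_mul.comp c1 b3'))
    (Primrec₂.natPair.comp
      (Primrec.nat_add.comp (Primrec.nat_mul.comp b2 c3') (Primrec.nat_mul.comp c2 b3'))
      (Primrec.nat_add.comp (Primrec.nat_mul.comp b3' c3) b3))

theorem primrec_ratNeg : Primrec ratNeg := by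
  have l : Primrec fun x : ℕ => x.unpair.1 := Primrec.fst.comp Primrec.unpair
  have r : Primrec fun x : ℕ => x.unpair.2 := Primrec.snd.comp Primrec.unpair
  exact Primrec₂.natPair.comp (l.comp r) (Primrec₂.natPair.comp l (r.comp r))

/-- The denominator is positive, so the sign is a comparison of naturals; the order on codes is
decided by applying this to a difference. -/
theorem rat_nonneg_iff (m : ℕ) : 0 ≤ rat m ↔ m.unpair.2.unpair.1 ≤ m.unpair.1 := by
  have h : (0 : ℚ) < (m.unpair.2.unpair.2 : ℚ) + 1 := by positivity
  rw [rat, le_div_iff₀ h, zero_mul, sub_nonneg, Nat.cast_le]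

theorem primrecRel_rat_le : PrimrecRel fun m n => rat m ≤ rat n := by
  have l : Primrec fun x : ℕ => x.unpair.1 := Primrec.fst.comp Primrec.unpair
  have r : Primrec fun x : ℕ => x.unpair.2 := Primrec.snd.comp Primrec.unpair
  have h0 : PrimrecPred fun m => 0 ≤ rat m :=
    (Primrec.nat_le.comp (l.comp r) l).of_eq fun m => (rat_nonneg_iff m).symm
  refine (h0.comp (primrec₂_ratAdd.comp Primrec.snd (primrec_ratNeg.comp Primrec.fst))).of_eq
    fun x => ?_
  rw [rat_ratAdd, rat_ratNeg, ← sub_eq_add_neg, sub_nonneg]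

theorem primrecRel_rat_lt : PrimrecRel fun m n => rat m < rat n :=
  (primrecRel_rat_le.comp Primrec.snd Primrec.fst).not.of_eq fun _ => not_le

theorem primrec₂_ratMin : Primrec₂ ratMin :=
  Primrec.ite primrecRel_rat_le Primrec.fst Primrec.snd

theorem primrec₂_ratMax : Primrec₂ ratMax :=
  Primrec.ite primrecRel_rat_le Primrec.snd Primrec.fst

theorem primrec_leftEnd : Primrec fun i : ℕ => i.unpair.1 :=
  Primrec.fst.comp Primrec.unpair

theorem primrec_rightEnd : Primrec rightEnd := by
  have l : Primrec fun x : ℕ => x.unpair.1 := Primrec.fst.comp Primrec.unpair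
  have r : Primrec fun x : ℕ => x.unpair.2 := Primrec.snd.comp Primrec.unpair
  exact primrec₂_ratAdd.comp l (primrec₂_ratFrac.comp (Primrec.succ.comp (l.comp r)) (r.comp r))

attribute [irreducible] ratAdd ratNeg ratFrac ratMin ratMax rightEnd

/-! ## Indices of rational intervals -/

theorem ratInterval_subset_iff (i j : ℕ) : ratInterval j ⊆ ratInterval i ↔
    rat i.unpair.1 ≤ rat j.unpair.1 ∧ rat (rightEnd j) ≤ rat (rightEnd i) := by
  rw [ratInterval_eq, ratInterval_eq,
    Set.Ioo_subset_Ioo_iff (Rat.cast_lt.2 (rat_left_lt_right j)), Rat.cast_le, Rat.cast_le]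

theorem isOpen_ratInterval (i : ℕ) : IsOpen (ratInterval i) := isOpen_Ioo

theorem exists_indexesOpen_ratInterval :
    ∃ o : ℕ → Code, Computable o ∧ ∀ i, IndexesOpen (o i) (ratInterval i) := by
  have h : PrimrecPred fun x : ℕ × ℕ => rat x.1.unpair.1 ≤ rat x.2.unpair.1 ∧
      rat (rightEnd x.2) ≤ rat (rightEnd x.1) :=
    (primrecRel_rat_le.comp (primrec_leftEnd.comp Primrec.fst)
      (primrec_leftEnd.comp Primrec.snd)).and
    (primrecRel_rat_le.comp (primrec_rightEnd.comp Primrec.snd)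
      (primrec_rightEnd.comp Primrec.fst))
  obtain ⟨o, ho, hoi⟩ := exists_indexesCE (p := fun i j => ratInterval j ⊆ ratInterval i)
    (h.computablePred.to_re.of_eq fun x => (ratInterval_subset_iff x.1 x.2).symm)
  exact ⟨o, ho, fun i => ⟨isOpen_ratInterval i, hoi i⟩⟩

/-! ## Tent functions -/

/-- The trapezoidal function of slope one and height `h` supported on `[a, b]`. -/
noncomputable def tent (a b h x : ℝ) : ℝ := max 0 (min h (min (x - a) (b - x)))

theorem continuous_tent (a b h : ℝ) : Continuous (tent a b h) := by
  unfold tent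
  fun_prop

theorem tent_nonneg (a b h x : ℝ) : 0 ≤ tent a b h x := le_max_left _ _

theorem tent_le {h : ℝ} (hh : 0 ≤ h) (a b x : ℝ) : tent a b h x ≤ h :=
  max_le hh (min_le_left _ _)

theorem tent_eq_zero {a b h x : ℝ} (hx : x ∉ Set.Ioo a b) : tent a b h x = 0 := by
  refine max_eq_left ((min_le_right _ _).trans ?_)
  by_contra hc
  rw [not_le, lt_min_iff] at hc
  exact hx ⟨by linarith, by linarith⟩

theorem tent_eq_of_mem {a b h x : ℝ} (hh : 0 ≤ h) (hx : x ∈ Set.Ioo (a + h) (b - h)) :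
    tent a b h x = h := by
  have h1 : h ≤ min (x - a) (b - x) := le_min (by linarith [hx.1]) (by linarith [hx.2])
  rw [tent, min_eq_left h1, max_eq_right hh]

theorem tsupport_tent {a b h : ℝ} (hab : a < b) (hh : 0 < h) :
    tsupport (tent a b h) = Set.Icc a b := by
  have : Function.support (tent a b h) = Set.Ioo a b := by
    ext x
    refine ⟨fun hx => by_contra fun hc => hx (tent_eq_zero hc), fun hx => ?_⟩
    exact (lt_max_of_lt_right (lt_min hh
      (lt_min (by linarith [hx.1]) (by linarith [hx.2])))).ne'
  rw [tsupport, this, closure_Ioo hab.ne]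

/-- Minimum and maximum are nonexpansive. This is why slope one is used: the rate demanded of a name
survives termwise application. -/
theorem abs_tent_sub_le (a b h x y : ℝ) : |tent a b h x - tent a b h y| ≤ |x - y| := by
  unfold tent
  refine (abs_max_sub_max_le_max _ _ _ _).trans (max_le (by simp) ?_)
  refine (abs_min_sub_min_le_max _ _ _ _).trans (max_le (by simp) ?_)
  refine (abs_min_sub_min_le_max _ _ _ _).trans (max_le ?_ ?_)
  · simp
  · rw [sub_sub_sub_cancel_left, abs_sub_comm]

/-- The tent function of height `1 / (s + 1)` on the closure of the interval coded by `i`. -/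
noncomputable def ratTent (x : ℕ × ℕ) : ℝ → ℝ :=
  tent (rat x.1.unpair.1) (rat (rightEnd x.1)) (1 / ((x.2 : ℝ) + 1))

theorem ratTent_le (x : ℕ × ℕ) (y : ℝ) : ratTent x y ≤ 1 / ((x.2 : ℝ) + 1) :=
  tent_le (by positivity) _ _ _

theorem ratTent_eq_zero {x : ℕ × ℕ} {y : ℝ} (hy : y ∉ ratInterval x.1) : ratTent x y = 0 := by
  rw [ratInterval_eq] at hy
  exact tent_eq_zero hy

theorem continuous_ratTent (x : ℕ × ℕ) : Continuous (ratTent x) := continuous_tent _ _ _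

/-- The support does not depend on the height, so a single name of the closed interval serves for
all trapezoids on it. -/
theorem tsupport_ratTent (x : ℕ × ℕ) : tsupport (ratTent x) =
    Set.Icc ((rat x.1.unpair.1 : ℚ) : ℝ) ((rat (rightEnd x.1) : ℚ) : ℝ) :=
  tsupport_tent (Rat.cast_lt.2 (rat_left_lt_right _)) (by positivity)

theorem hasCompactSupport_ratTent (x : ℕ × ℕ) : HasCompactSupport (ratTent x) := by
  rw [HasCompactSupport, tsupport_ratTent]
  exact isCompact_Icc

/-- At rational points the trapezoid is exact rational arithmetic, and it is 1-Lipschitz; hence the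
n-th term of the output needs only the n-th term of the input name. -/
theorem exists_indexesFunction_ratTent :
    ∃ c : ℕ × ℕ → OracleCode, Computable c ∧ ∀ x, IndexesFunction (c x) (ratTent x) := by
  let F : ℕ × ℕ → ℕ → ℕ := fun x n =>
    ratMax (ratFrac 0 0) (ratMin (ratFrac 1 x.2)
      (ratMin (ratAdd n (ratNeg x.1.unpair.1)) (ratAdd (rightEnd x.1) (ratNeg n))))
  have hF : Primrec₂ F := by
    have h1 : Primrec fun y : (ℕ × ℕ) × ℕ => y.1.1 := Primrec.fst.comp Primrec.fst
    have h2 : Primrec fun y : (ℕ × ℕ) × ℕ => y.1.2 := Primrec.snd.comp Primrec.fst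
    exact primrec₂_ratMax.comp (Primrec.const _) (primrec₂_ratMin.comp
      (primrec₂_ratFrac.comp (Primrec.const 1) h2) (primrec₂_ratMin.comp
      (primrec₂_ratAdd.comp Primrec.snd (primrec_ratNeg.comp (primrec_leftEnd.comp h1)))
      (primrec₂_ratAdd.comp (primrec_rightEnd.comp h1) (primrec_ratNeg.comp Primrec.snd))))
  have hval : ∀ x n, ((rat (F x n) : ℚ) : ℝ) = ratTent x (rat n) := by
    intro x n
    simp only [F, rat_ratMax, rat_ratMin, rat_ratFrac, rat_ratAdd, rat_ratNeg, ratTent, tent,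
      ← sub_eq_add_neg]
    push_cast
    simp
  obtain ⟨c, hc, hcF⟩ := OracleCode.exists_eval_eq hF.to_comp
  refine ⟨c, hc, fun x y ρ hρ => ⟨fun n => F x (ρ n), hcF x ρ, ?_, fun n => ?_⟩⟩
  · simp only [hval]
    exact ((continuous_ratTent x).tendsto y).comp hρ.1
  · refine lt_of_le_of_lt ?_ (hρ.2 n)
    rw [← Rat.cast_le (K := ℝ)]
    push_cast
    rw [hval, hval]
    exact abs_tent_sub_le _ _ _ _ _

theorem isCompactlySupportedComputable_ratTent (x : ℕ × ℕ) :
    IsCompactlySupportedComputable (ratTent x) := by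
  obtain ⟨c, -, hc⟩ := exists_indexesFunction_ratTent
  exact ⟨continuous_ratTent x, hasCompactSupport_ratTent x, c x, hc x⟩

/-! ## Names of compact intervals -/

/-- Whether finitely many open intervals cover `[a, b]` can be tested on the point `a` and the right
endpoints of the intervals. -/
theorem Icc_subset_biUnion_Ioo_iff {ι : Type*} {a b : ℝ} (hab : a ≤ b) (l : List ι) (L R : ι → ℝ) :
    Set.Icc a b ⊆ ⋃ i ∈ l, Set.Ioo (L i) (R i) ↔
      (∃ i ∈ l, a ∈ Set.Ioo (L i) (R i)) ∧
        ∀ j ∈ l, R j ∈ Set.Icc a b → ∃ i ∈ l, R j ∈ Set.Ioo (L i) (R i) := by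
  simp only [Set.subset_def, Set.mem_iUnion, exists_prop]
  refine ⟨fun h => ⟨h a (Set.left_mem_Icc.2 hab), fun j _ hj => h _ hj⟩, fun ⟨ha, h⟩ x hx => ?_⟩
  by_contra hc
  push Not at hc
  -- Below an uncovered x, take the largest test point p. An interval containing p cannot reach past
  -- x, so its right endpoint is a larger test point in [a, x].
  let T : Set ℝ := {p | (p = a ∨ ∃ j ∈ l, R j = p) ∧ p ∈ Set.Icc a x}
  have hT : T.Finite := by
    refine Set.Finite.subset (Set.Finite.insert a (l.finite_toSet.image R)) fun p hp => ?_
    rcases hp.1 with rfl | ⟨j, hj, rfl⟩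
    · exact Set.mem_insert _ _
    · exact Set.mem_insert_of_mem _ ⟨j, hj, rfl⟩
  obtain ⟨p, hp, hmax⟩ := Set.exists_max_image T id hT ⟨a, Or.inl rfl, le_rfl, hx.1⟩
  obtain ⟨i, hi, hpi⟩ : ∃ i ∈ l, p ∈ Set.Ioo (L i) (R i) := by
    rcases hp.1 with rfl | ⟨j, hj, rfl⟩
    · exact ha
    · exact h j hj ⟨hp.2.1, hp.2.2.trans hx.2⟩
  have hix : R i ≤ x := by
    by_contra hlt
    exact hc i hi ⟨hpi.1.trans_le hp.2.2, not_le.1 hlt⟩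
  exact absurd (hmax (R i) ⟨Or.inr ⟨i, hi, rfl⟩, hp.2.1.trans hpi.2.le, hix⟩) (not_le.2 hpi.2)

/-- The closed interval `[a, b]` for the code `i` of `(a, b)`. -/
def ratIcc (i : ℕ) : Set ℝ :=
  Set.Icc ((rat i.unpair.1 : ℚ) : ℝ) ((rat (rightEnd i) : ℚ) : ℝ)

theorem primrecRel_isCover_ratIcc : PrimrecRel fun i l => IsCover l (ratIcc i) := by
  have hmem : PrimrecRel fun j p => rat j.unpair.1 < rat p ∧ rat p < rat (rightEnd j) :=
    (primrecRel_rat_lt.comp (primrec_leftEnd.comp Primrec.fst) Primrec.snd).and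
      (primrecRel_rat_lt.comp Primrec.snd (primrec_rightEnd.comp Primrec.fst))
  have hR : PrimrecRel fun (j : ℕ) (y : ℕ × List ℕ) =>
      (rat y.1.unpair.1 ≤ rat (rightEnd j) ∧ rat (rightEnd j) ≤ rat (rightEnd y.1)) →
        ∃ k ∈ y.2, rat k.unpair.1 < rat (rightEnd j) ∧ rat (rightEnd j) < rat (rightEnd k) := by
    have h1 : PrimrecPred fun x : ℕ × ℕ × List ℕ => rat x.2.1.unpair.1 ≤ rat (rightEnd x.1) :=
      primrecRel_rat_le.comp (primrec_leftEnd.comp (Primrec.fst.comp Primrec.snd))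
        (primrec_rightEnd.comp Primrec.fst)
    have h2 : PrimrecPred fun x : ℕ × ℕ × List ℕ => rat (rightEnd x.1) ≤ rat (rightEnd x.2.1) :=
      primrecRel_rat_le.comp (primrec_rightEnd.comp Primrec.fst)
        (primrec_rightEnd.comp (Primrec.fst.comp Primrec.snd))
    have h3 := hmem.exists_mem_list.comp (Primrec.snd.comp Primrec.snd)
      (primrec_rightEnd.comp (Primrec.fst (α := ℕ) (β := ℕ × List ℕ)))
    exact ((h1.and h2).not.or h3).of_eq fun x => imp_iff_not_or.symm
  have hL := hmem.exists_mem_list.comp (Primrec.snd (α := ℕ) (β := List ℕ))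
    (primrec_leftEnd.comp Primrec.fst)
  refine (hL.and (hR.forall_mem_list.comp (Primrec.snd (α := ℕ) (β := List ℕ))
    Primrec.id)).of_eq fun x => ?_
  simp only [IsCover, ratIcc, ratInterval_eq]
  rw [Icc_subset_biUnion_Ioo_iff (Rat.cast_le.2 (rat_left_lt_right _).le)]
  simp only [Set.mem_Ioo, Set.mem_Icc, Rat.cast_lt, Rat.cast_le, id]

/-- A proper sublist misses some position, so minimality of a cover only has to be tested by single
deletions. -/
theorem exists_sublist_eraseIdx {α : Type*} {l' l : List α} (h : l'.Sublist l) (hne : l' ≠ l) :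
    ∃ j < l.length, l'.Sublist (l.eraseIdx j) := by
  induction h with
  | slnil => exact absurd rfl hne
  | cons a h _ => exact ⟨0, by simp, by simpa using h⟩
  | cons_cons a h ih =>
    obtain ⟨j, hj, hs⟩ := ih fun he => hne (by rw [he])
    exact ⟨j + 1, by simpa using hj, by simpa using hs⟩

theorem IsCover.mono {l l' : List ℕ} {K : Set ℝ} (h : IsCover l' K) (hl : l'.Sublist l) :
    IsCover l K :=
  h.trans (Set.biUnion_subset_biUnion_left fun _ hi => hl.subset hi)

theorem isMinimalCover_iff (l : List ℕ) (K : Set ℝ) :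
    IsMinimalCover l K ↔ IsCover l K ∧ ∀ j < l.length, ¬ IsCover (l.eraseIdx j) K := by
  refine and_congr_right fun _ => ⟨fun h j hj => h _ (List.eraseIdx_sublist _ _) fun he => ?_,
    fun h l' hs hne hc => ?_⟩
  · exact (List.eraseIdx_eq_self.1 he).not_gt hj
  · obtain ⟨j, hj, hs'⟩ := exists_sublist_eraseIdx hs hne
    exact h j hj (hc.mono hs')

theorem primrecRel_isMinimalCover_ratIcc :
    PrimrecRel fun i l => IsMinimalCover l (ratIcc i) := by
  have hE : Primrec fun x : ℕ × ℕ × List ℕ => x.2.2.eraseIdx x.1 :=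
    (Primrec.list_append.comp
      (Primrec.list_take.comp Primrec.fst (Primrec.snd.comp Primrec.snd))
      (Primrec.list_drop.comp (Primrec.succ.comp Primrec.fst)
        (Primrec.snd.comp Primrec.snd))).of_eq fun x => (List.eraseIdx_eq_take_drop_succ _ _).symm
  have hR : PrimrecRel fun (j : ℕ) (y : ℕ × List ℕ) => ¬ IsCover (y.2.eraseIdx j) (ratIcc y.1) :=
    (primrecRel_isCover_ratIcc.comp (Primrec.fst.comp Primrec.snd) hE).not
  have hF : PrimrecPred fun x : ℕ × List ℕ =>
      ∀ j < x.2.length, ¬ IsCover (x.2.eraseIdx j) (ratIcc x.1) :=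
    (hR.forall_mem_list.comp (Primrec.list_range.comp (Primrec.list_length.comp Primrec.snd))
      Primrec.id).of_eq fun x => by simp
  exact (primrecRel_isCover_ratIcc.and hF).of_eq
      fun x => (isMinimalCover_iff x.2 (ratIcc x.1)).symm

/-- A code of the interval `(a - 1, b + 1)` for a code of `(a, b)`. -/
def enlarge (i : ℕ) : ℕ :=
  Nat.pair (ratAdd i.unpair.1 (ratNeg (ratFrac 1 0)))
    (Nat.pair (i.unpair.2.unpair.1 + 2 * (i.unpair.2.unpair.2 + 1)) i.unpair.2.unpair.2)

theorem rat_left_enlarge (i : ℕ) : rat (enlarge i).unpair.1 = rat i.unpair.1 - 1 := by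
  simp [enlarge, rat_ratAdd, rat_ratNeg, rat_ratFrac, sub_eq_add_neg]

/-- Raising the numerator of the length by twice its denominator lengthens the interval by 2, while
the left endpoint moves by 1. -/
theorem rat_rightEnd_enlarge (i : ℕ) : rat (rightEnd (enlarge i)) = rat (rightEnd i) + 1 := by
  have h : ((i.unpair.2.unpair.2 : ℚ) + 1) ≠ 0 := by positivity
  rw [rat_rightEnd, rat_left_enlarge, rat_rightEnd]
  simp only [enlarge, posRat, Nat.unpair_pair]
  push_cast
  field_simp
  ring

theorem isMinimalCover_enlarge (i : ℕ) : IsMinimalCover [enlarge i] (ratIcc i) := by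
  rw [isMinimalCover_iff]
  constructor
  · simp only [IsCover, ratInterval_eq, List.mem_singleton, Set.iUnion_iUnion_eq_left,
      rat_left_enlarge, rat_rightEnd_enlarge, ratIcc]
    push_cast
    exact Set.Icc_subset_Ioo (by linarith) (by linarith)
  · intro j hj h
    obtain rfl : j = 0 := by simpa using hj
    have : ((rat i.unpair.1 : ℚ) : ℝ) ∈ ratIcc i :=
      Set.left_mem_Icc.2 (Rat.cast_le.2 (rat_left_lt_right i).le)
    simpa using h this

theorem primrec_enlarge : Primrec enlarge := by
  have l : Primrec fun x : ℕ => x.unpair.1 := Primrec.fst.comp Primrec.unpair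
  have r : Primrec fun x : ℕ => x.unpair.2 := Primrec.snd.comp Primrec.unpair
  exact Primrec₂.natPair.comp (primrec₂_ratAdd.comp l (Primrec.const _))
    (Primrec₂.natPair.comp (Primrec.nat_add.comp (l.comp r) (Primrec.nat_mul.comp (Primrec.const 2)
      (Primrec.succ.comp (r.comp r)))) (r.comp r))

/-- Run through all lists and keep those that pass the decidable test. A name is a total sequence,
so failures are replaced by a fixed minimal cover, the enlarged interval. -/
theorem exists_indexesCompact_ratIcc :
    ∃ k : ℕ → Code, Computable k ∧ ∀ i, IndexesCompact (k i) (ratIcc i) := by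
  classical
  let dec : ℕ → List ℕ := fun n => (Encodable.decode n).getD []
  have hdec : Primrec dec := Primrec.option_getD.comp Primrec.decode (Primrec.const [])
  let p : ℕ → ℕ → List ℕ := fun i n =>
    if IsMinimalCover (dec n) (ratIcc i) then dec n else [enlarge i]
  have hp : Primrec₂ p := by
    refine Primrec.ite (primrecRel_isMinimalCover_ratIcc.comp Primrec.fst
      (hdec.comp Primrec.snd)) (hdec.comp Primrec.snd) ?_
    exact Primrec.list_cons.comp (primrec_enlarge.comp Primrec.fst) (Primrec.const [])
  obtain ⟨k, hk, hkp⟩ := exists_computes hp.to_comp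
  refine ⟨k, hk, fun i => ⟨isCompact_Icc, p i, hkp i, ?_⟩⟩
  ext l
  constructor
  · rintro ⟨n, rfl⟩
    by_cases h : IsMinimalCover (dec n) (ratIcc i)
    · simp only [p, if_pos h]
      exact h
    · simp only [p, if_neg h]
      exact isMinimalCover_enlarge i
  · intro h
    have hd : dec (Encodable.encode l) = l := by simp [dec]
    exact ⟨Encodable.encode l, by simp only [p, hd]; exact if_pos h⟩

/-! ## Measures of open sets and of rational intervals -/

theorem measurableSet_ratInterval (i : ℕ) : MeasurableSet (ratInterval i) := measurableSet_Ioo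

theorem disjoint_ratInterval_iff (i j : ℕ) : Disjoint (ratInterval i) (ratInterval j) ↔
    rat (rightEnd i) ≤ rat j.unpair.1 ∨ rat (rightEnd j) ≤ rat i.unpair.1 := by
  have hi := rat_left_lt_right i
  have hj := rat_left_lt_right j
  rw [ratInterval_eq, ratInterval_eq, Set.Ioo_disjoint_Ioo]
  norm_cast
  rw [min_le_iff, le_max_iff, le_max_iff]
  constructor
  · rintro ((h | h) | (h | h))
    · exact absurd h (not_le.2 hi)
    · exact Or.inl h
    · exact Or.inr h
    · exact absurd h (not_le.2 hj)
  · rintro (h | h)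
    · exact Or.inl (Or.inr h)
    · exact Or.inr (Or.inl h)

theorem exists_ratInterval_union {i j : ℕ} (h : ¬ Disjoint (ratInterval i) (ratInterval j)) :
    ∃ k, ratInterval k = ratInterval i ∪ ratInterval j := by
  have hi := rat_left_lt_right i
  rw [disjoint_ratInterval_iff, not_or, not_le, not_le] at h
  obtain ⟨k, hk⟩ := exists_ratInterval_eq (min (rat i.unpair.1) (rat j.unpair.1))
    (max (rat (rightEnd i)) (rat (rightEnd j))) (lt_max_of_lt_left (min_lt_of_left_lt hi))
  refine ⟨k, ?_⟩
  rw [hk, ratInterval_eq, ratInterval_eq,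
    Set.Ioo_union_Ioo' (Rat.cast_lt.2 h.1) (Rat.cast_lt.2 h.2)]
  push_cast
  rfl

theorem exists_finset_cover {K U : Set ℝ} (hK : IsCompact K) (hU : IsOpen U) (hKU : K ⊆ U) :
    ∃ S : Finset ℕ, (∀ i ∈ S, ratInterval i ⊆ U) ∧ K ⊆ ⋃ i ∈ S, ratInterval i := by
  have hloc : ∀ x ∈ K, ∃ i, ratInterval i ⊆ U ∧ x ∈ ratInterval i := by
    intro x hx
    obtain ⟨ε, hε, hball⟩ := Metric.isOpen_iff.1 hU x (hKU hx)
    obtain ⟨a, ha, hax⟩ := exists_rat_btwn (sub_lt_self x hε)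
    obtain ⟨b, hxb, hb⟩ := exists_rat_btwn (lt_add_of_pos_right x hε)
    obtain ⟨i, hi⟩ := exists_ratInterval_eq a b (by exact_mod_cast hax.trans hxb)
    refine ⟨i, ?_, hi ▸ ⟨hax, hxb⟩⟩
    rw [hi]
    refine subset_trans ?_ hball
    rw [Real.ball_eq_Ioo]
    exact Set.Ioo_subset_Ioo ha.le hb.le
  obtain ⟨S, hS⟩ := hK.elim_finite_subcover
    (fun i : {i // ratInterval i ⊆ U} => ratInterval i) (fun i => isOpen_ratInterval i)
    fun x hx => by
      obtain ⟨i, hi, hxi⟩ := hloc x hx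
      exact Set.mem_iUnion.2 ⟨⟨i, hi⟩, hxi⟩
  refine ⟨S.map (Function.Embedding.subtype _), fun i hi => ?_, hS.trans ?_⟩
  · obtain ⟨j, -, rfl⟩ := Finset.mem_map.1 hi
    exact j.2
  · exact Set.iUnion₂_subset fun i hi => Set.subset_biUnion_of_mem
      (u := ratInterval) (Finset.mem_map_of_mem (Function.Embedding.subtype _) hi)

/-- A compact subset of an open set is covered by finitely many pairwise disjoint rational
intervals inside the open set. -/
theorem exists_pairwiseDisjoint_cover {K U : Set ℝ} (hK : IsCompact K) (hU : IsOpen U)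
    (hKU : K ⊆ U) :
    ∃ S : Finset ℕ, (∀ i ∈ S, ratInterval i ⊆ U) ∧ K ⊆ (⋃ i ∈ S, ratInterval i) ∧
      (S : Set ℕ).PairwiseDisjoint ratInterval := by
  classical
  -- In a cover of least cardinality no two intervals meet, since merging two that do would give a
  -- smaller cover.
  let P : ℕ → Prop := fun n => ∃ S : Finset ℕ, S.card = n ∧ (∀ i ∈ S, ratInterval i ⊆ U) ∧
    K ⊆ ⋃ i ∈ S, ratInterval i
  have hP : ∃ n, P n := by
    obtain ⟨S, hS⟩ := exists_finset_cover hK hU hKU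
    exact ⟨_, S, rfl, hS⟩
  obtain ⟨S, hcard, hSU, hKS⟩ := Nat.find_spec hP
  refine ⟨S, hSU, hKS, fun i hi j hj hij => by_contra fun hd => ?_⟩
  obtain ⟨k, hk⟩ := exists_ratInterval_union hd
  refine Nat.find_min hP (m := (insert k ((S.erase i).erase j)).card) ?_ ⟨_, rfl, ?_, ?_⟩
  · rw [← hcard]
    have h1 := Finset.card_erase_add_one (Finset.mem_coe.1 hi)
    have h2 := Finset.card_erase_add_one (Finset.mem_erase.2 ⟨hij.symm, Finset.mem_coe.1 hj⟩)
    have h3 := Finset.card_insert_le k ((S.erase i).erase j)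
    omega
  · intro l hl
    rcases Finset.mem_insert.1 hl with rfl | hl
    · rw [hk]
      exact Set.union_subset (hSU i hi) (hSU j hj)
    · exact hSU l (Finset.mem_of_mem_erase (Finset.mem_of_mem_erase hl))
  · intro x hx
    obtain ⟨l, hl, hxl⟩ := Set.mem_iUnion₂.1 (hKS hx)
    by_cases h : l = i ∨ l = j
    · refine Set.mem_iUnion₂.2 ⟨k, Finset.mem_insert_self _ _, ?_⟩
      rw [hk]
      rcases h with rfl | rfl
      · exact Or.inl hxl
      · exact Or.inr hxl
    · rw [not_or] at h
      exact Set.mem_iUnion₂.2 ⟨l, Finset.mem_insert_of_mem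
        (Finset.mem_erase.2 ⟨h.2, Finset.mem_erase.2 ⟨h.1, hl⟩⟩), hxl⟩

/-- Each term loses less than δ. Dividing the gap by |S| + 1 keeps the total loss below the gap and
also handles empty S. -/
theorem exists_rat_sum_gt {ι : Type*} (S : Finset ι) (a : ι → ℝ) {q : ℝ} (hq : q < ∑ i ∈ S, a i) :
    ∃ r : ι → ℚ, (∀ i, (r i : ℝ) < a i) ∧ q < ∑ i ∈ S, (r i : ℝ) := by
  have hN : (0 : ℝ) < S.card + 1 := by positivity
  set δ := (∑ i ∈ S, a i - q) / (S.card + 1) with hδ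
  have hδ0 : 0 < δ := div_pos (sub_pos.2 hq) hN
  choose r hr1 hr2 using fun i => exists_rat_btwn (sub_lt_self (a i) hδ0)
  refine ⟨r, hr2, ?_⟩
  have h1 : ∑ i ∈ S, (a i - δ) ≤ ∑ i ∈ S, (r i : ℝ) := Finset.sum_le_sum fun i _ => (hr1 i).le
  rw [Finset.sum_sub_distrib, Finset.sum_const, nsmul_eq_mul] at h1
  have h2 : (S.card + 1) * δ = ∑ i ∈ S, a i - q := by
    rw [hδ]
    field_simp
  linarith

/-- Induction that removes the first interval from U: by disjointness the remaining ones lie in the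
difference. -/
theorem sum_le_measureReal {ν : Measure ℝ} [IsFiniteMeasure ν] (L : List (ℕ × ℕ)) {U : Set ℝ}
    (hL : ∀ x ∈ L, ratInterval x.1 ⊆ U ∧ ((rat x.2 : ℚ) : ℝ) < ν.real (ratInterval x.1))
    (hd : L.Pairwise fun x y => Disjoint (ratInterval x.1) (ratInterval y.1)) :
    (((L.map fun x => rat x.2).sum : ℚ) : ℝ) ≤ ν.real U := by
  induction L generalizing U with
  | nil => simp
  | cons x L ih =>
    rw [List.pairwise_cons] at hd
    have hx := hL x List.mem_cons_self
    have h1 := ih (U := U \ ratInterval x.1) (fun y hy =>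
      ⟨Set.subset_sdiff.2 ⟨(hL y (List.mem_cons_of_mem _ hy)).1, (hd.1 y hy).symm⟩,
        (hL y (List.mem_cons_of_mem _ hy)).2⟩) hd.2
    have h2 := measureReal_inter_add_sdiff (μ := ν) (s := U) (measurableSet_ratInterval x.1)
    rw [Set.inter_eq_right.2 hx.1] at h2
    rw [List.map_cons, List.sum_cons]
    push_cast
    push_cast at h1
    linarith [hx.2]

/-- The left cut of the measure of an open set in terms of the left cuts of the measures of
rational intervals. -/
theorem lt_measureReal_iff {ν : Measure ℝ} [IsFiniteMeasure ν] {U : Set ℝ} (hU : IsOpen U)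
    (q : ℚ) : (q : ℝ) < ν.real U ↔ ∃ L : List (ℕ × ℕ),
      (∀ x ∈ L, ratInterval x.1 ⊆ U ∧ ((rat x.2 : ℚ) : ℝ) < ν.real (ratInterval x.1)) ∧
      (L.Pairwise fun x y => Disjoint (ratInterval x.1) (ratInterval y.1)) ∧
      q < (L.map fun x => rat x.2).sum := by
  constructor
  · intro h
    obtain ⟨S, hSU, hsum, hd⟩ : ∃ S : Finset ℕ, (∀ i ∈ S, ratInterval i ⊆ U) ∧
        (q : ℝ) < ∑ i ∈ S, ν.real (ratInterval i) ∧ (S : Set ℕ).PairwiseDisjoint ratInterval := by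
      -- For negative q the empty family works. Otherwise inner regularity gives a compact set of
      -- measure above q, and a disjoint cover of it does at least as well.
      rcases lt_or_ge (q : ℝ) 0 with hq | hq
      · exact ⟨∅, by simp, by simpa using hq, by simp⟩
      · have h' : ENNReal.ofReal q < ν U := by
          rwa [← ENNReal.ofReal_toReal (measure_ne_top ν U),
            ENNReal.ofReal_lt_ofReal_iff_of_nonneg hq]
        obtain ⟨K, hKU, hK, hqK⟩ := hU.exists_lt_isCompact h'
        obtain ⟨S, hSU, hKS, hd⟩ := exists_pairwiseDisjoint_cover hK hU hKU
        refine ⟨S, hSU, ?_, hd⟩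
        have h1 : (q : ℝ) < ν.real K := by
          rwa [← ENNReal.ofReal_toReal (measure_ne_top ν K),
            ENNReal.ofReal_lt_ofReal_iff_of_nonneg hq] at hqK
        exact h1.trans_le ((measureReal_mono hKS (measure_ne_top _ _)).trans (measureReal_biUnion_finset_le _ _))
    obtain ⟨r, hr, hqr⟩ := exists_rat_sum_gt S _ hsum
    choose c hc using fun i => exists_rat_eq (r i)
    refine ⟨S.toList.map fun i => (i, c i), ?_, ?_, ?_⟩
    · simp only [List.mem_map, Finset.mem_toList]
      rintro _ ⟨i, hi, rfl⟩
      exact ⟨hSU i hi, by simpa only [hc] using hr i⟩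
    · rw [List.pairwise_map]
      exact (S.nodup_toList.pairwise_of_forall_ne fun i hi j hj hij =>
        hd (by simpa using hi) (by simpa using hj) hij)
    · rw [List.map_map]
      have : (fun x : ℕ × ℕ => rat x.2) ∘ (fun i => (i, c i)) = r := funext hc
      rw [this, Finset.sum_map_toList]
      exact_mod_cast hqr
  · rintro ⟨L, hL, hd, hq⟩
    exact (Rat.cast_lt.2 hq).trans_le (sum_le_measureReal L hL hd)

/-! ## Integrals of tent functions -/

theorem integrable_ratTent (ν : Measure ℝ) [IsFiniteMeasure ν] (x : ℕ × ℕ) :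
    Integrable (ratTent x) ν :=
  (continuous_ratTent x).integrable_of_hasCompactSupport (hasCompactSupport_ratTent x)

theorem integral_ratTent_le (ν : Measure ℝ) [IsFiniteMeasure ν] (x : ℕ × ℕ) :
    ∫ y, ratTent x y ∂ν ≤ 1 / ((x.2 : ℝ) + 1) * ν.real (ratInterval x.1) := by
  have h : ∀ y, ratTent x y ≤ (ratInterval x.1).indicator (fun _ => 1 / ((x.2 : ℝ) + 1)) y := by
    intro y
    by_cases hy : y ∈ ratInterval x.1
    · rw [Set.indicator_of_mem hy]
      exact ratTent_le x y
    · rw [Set.indicator_of_notMem hy, ratTent_eq_zero hy]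
  refine (integral_mono (integrable_ratTent ν x)
    ((integrable_const _).indicator (measurableSet_ratInterval x.1)) h).trans_eq ?_
  rw [integral_indicator_const _ (measurableSet_ratInterval x.1), smul_eq_mul, mul_comm]

theorem le_integral_ratTent (ν : Measure ℝ) [IsFiniteMeasure ν] (x : ℕ × ℕ) {V : Set ℝ}
    (hV : MeasurableSet V) (hVx : ∀ y ∈ V, ratTent x y = 1 / ((x.2 : ℝ) + 1)) :
    1 / ((x.2 : ℝ) + 1) * ν.real V ≤ ∫ y, ratTent x y ∂ν := by
  have h : ∀ y, V.indicator (fun _ => 1 / ((x.2 : ℝ) + 1)) y ≤ ratTent x y := by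
    intro y
    by_cases hy : y ∈ V
    · rw [Set.indicator_of_mem hy, hVx y hy]
    · rw [Set.indicator_of_notMem hy]
      exact tent_nonneg _ _ _ _
  refine le_trans (le_of_eq ?_) (integral_mono ((integrable_const _).indicator hV)
    (integrable_ratTent ν x) h)
  rw [integral_indicator_const _ hV, smul_eq_mul, mul_comm]

/-- The interval coded by `j` is inside the one coded by `i`, at distance at least `1 / (s + 1)` from
its complement. -/
def IsNested (j i s : ℕ) : Prop :=
  rat i.unpair.1 + rat (ratFrac 1 s) ≤ rat j.unpair.1 ∧
    rat (rightEnd j) + rat (ratFrac 1 s) ≤ rat (rightEnd i)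

theorem IsNested.ratTent_eq {j i s : ℕ} (h : IsNested j i s) {y : ℝ} (hy : y ∈ ratInterval j) :
    ratTent (i, s) y = 1 / ((s : ℝ) + 1) := by
  rw [ratInterval_eq] at hy
  have h1 : ((rat i.unpair.1 + rat (ratFrac 1 s) : ℚ) : ℝ) ≤ _ := Rat.cast_le.2 h.1
  have h2 : ((rat (rightEnd j) + rat (ratFrac 1 s) : ℚ) : ℝ) ≤ _ := Rat.cast_le.2 h.2
  rw [rat_ratFrac] at h1 h2
  push_cast at h1 h2
  exact tent_eq_of_mem (by positivity) ⟨by linarith [hy.1], by linarith [hy.2]⟩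

/-- An interval is exhausted by nested chains of smaller intervals. -/
theorem exists_isNested_lt (ν : Measure ℝ) [IsFiniteMeasure ν] (i : ℕ) {q : ℝ}
    (hq : q < ν.real (ratInterval i)) :
    ∃ j k s, IsNested j i s ∧ IsNested k j s ∧ q < ν.real (ratInterval k) := by
  set a := rat i.unpair.1 with ha
  set b := rat (rightEnd i) with hb
  have hab : a < b := rat_left_lt_right i
  -- Twice the margin is removed at each end: `k` will be `V s`, and `j` lies halfway, one margin
  -- from both `k` and `i`.
  let V : ℕ → Set ℝ := fun s => Set.Ioo ((a : ℝ) + 2 / ((s : ℝ) + 1)) ((b : ℝ) - 2 / ((s : ℝ) + 1))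
  have hlim : Tendsto (fun s : ℕ => 2 / ((s : ℝ) + 1)) atTop (𝓝 0) := by
    have := (tendsto_one_div_add_atTop_nhds_zero_nat (𝕜 := ℝ)).const_mul 2
    simpa [div_eq_mul_inv] using this
  have hmono : Monotone V := by
    intro s t hst
    have : 2 / ((t : ℝ) + 1) ≤ 2 / ((s : ℝ) + 1) := by gcongr
    exact Set.Ioo_subset_Ioo (by linarith) (by linarith)
  have hunion : ⋃ s, V s = ratInterval i := by
    rw [ratInterval_eq]
    ext x
    simp only [Set.mem_iUnion, V, Set.mem_Ioo]
    constructor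
    · rintro ⟨s, h1, h2⟩
      have : (0 : ℝ) < 2 / ((s : ℝ) + 1) := by positivity
      exact ⟨by linarith, by linarith⟩
    · rintro ⟨h1, h2⟩
      obtain ⟨s, hs1, hs2⟩ := ((hlim.eventually_lt_const (sub_pos.2 h1)).and
        (hlim.eventually_lt_const (sub_pos.2 h2))).exists
      exact ⟨s, by linarith, by linarith⟩
  have htend : Tendsto (fun s => ν.real (V s)) atTop (𝓝 (ν.real (ratInterval i))) := by
    rw [← hunion]
    exact (ENNReal.tendsto_toReal (measure_ne_top _ _)).comp
      (tendsto_measure_iUnion_atTop hmono)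
  -- Ensures that s is large enough for the endpoints of `k` not to cross.
  have hlen : (0 : ℝ) < (b - a) / 2 := by
    have : (a : ℝ) < b := Rat.cast_lt.2 hab
    linarith
  obtain ⟨s, hs1, hs2⟩ := ((htend.eventually_const_lt hq).and
    (hlim.eventually_lt_const hlen)).exists
  have hs3 : 2 / ((s : ℚ) + 1) < (b - a) / 2 := by
    have : ((2 / ((s : ℚ) + 1) : ℚ) : ℝ) < (((b - a) / 2 : ℚ) : ℝ) := by
      push_cast
      exact hs2
    exact Rat.cast_lt.1 this
  have h2 : 2 / ((s : ℚ) + 1) = 1 / ((s : ℚ) + 1) + 1 / ((s : ℚ) + 1) := by ring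
  have h0 : (0 : ℚ) < 1 / ((s : ℚ) + 1) := by positivity
  have hex : ∀ u v : ℚ, u < v → ∃ j, rat j.unpair.1 = u ∧ rat (rightEnd j) = v := by
    intro u v huv
    obtain ⟨m, hm⟩ := exists_rat_eq u
    obtain ⟨n, hn⟩ := exists_posRat_eq (v - u) (sub_pos.2 huv)
    exact ⟨Nat.pair m n, by simp [hm], by simp [rat_rightEnd, hm, hn]⟩
  obtain ⟨j, hj1, hj2⟩ := hex (a + 1 / ((s : ℚ) + 1)) (b - 1 / ((s : ℚ) + 1)) (by linarith)
  obtain ⟨k, hk1, hk2⟩ := hex (a + 2 / ((s : ℚ) + 1)) (b - 2 / ((s : ℚ) + 1)) (by linarith)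
  refine ⟨j, k, s, ?_, ?_, ?_⟩
  · rw [IsNested, hj1, hj2, rat_ratFrac]
    push_cast
    exact ⟨le_rfl, by linarith⟩
  · rw [IsNested, hj1, hj2, hk1, hk2, rat_ratFrac]
    push_cast
    exact ⟨by linarith, by linarith⟩
  · rw [ratInterval_eq, hk1, hk2]
    push_cast
    exact hs1

/-! ## Left cuts of measures -/

/-- The sum of the second components of a list of pairs, on codes of rational numbers. -/
def ratSum (L : List (ℕ × ℕ)) : ℕ :=
  L.foldr (fun x s => ratAdd x.2 s) (ratFrac 0 0)

theorem rat_ratSum (L : List (ℕ × ℕ)) : rat (ratSum L) = (L.map fun x => rat x.2).sum := by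
  induction L with
  | nil => simp [ratSum, rat_ratFrac]
  | cons x L ih =>
    rw [List.map_cons, List.sum_cons, ← ih, ← rat_ratAdd]
    rfl

theorem primrec_ratSum : Primrec ratSum := by
  have h : Primrec₂ fun (_ : List (ℕ × ℕ)) (x : (ℕ × ℕ) × ℕ) => ratAdd x.1.2 x.2 :=
    primrec₂_ratAdd.comp (Primrec.snd.comp (Primrec.fst.comp Primrec.snd))
      (Primrec.snd.comp Primrec.snd)
  exact Primrec.list_foldr Primrec.id (Primrec.const _) h

theorem primrecPred_pairwise {α : Type*} [Primcodable α] {R : α → α → Prop} (hR : PrimrecRel R) :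
    PrimrecPred fun L : List α => L.Pairwise R := by
  classical
  have hR' : PrimrecRel fun b a => R a b := hR.comp Primrec.snd Primrec.fst
  let h : List α → α × List α × Bool → Bool := fun _ x =>
    decide (∀ b ∈ x.2.1, R x.1 b) && x.2.2
  have hh : Primrec₂ h := by
    have h1 : PrimrecPred fun y : List α × α × List α × Bool => ∀ b ∈ y.2.2.1, R y.2.1 b :=
      hR'.forall_mem_list.comp (Primrec.fst.comp (Primrec.snd.comp Primrec.snd))
        (Primrec.fst.comp Primrec.snd)
    exact Primrec.and.comp h1.decide
      (Primrec.snd.comp (Primrec.snd.comp Primrec.snd))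
  have hrec := Primrec.list_rec (f := fun L : List α => L) Primrec.id (Primrec.const true) hh
  refine (Primrec.primrecPred (p := fun L : List α => (List.recOn L true fun b l IH =>
    h L (b, l, IH) : Bool) = true) (hrec.of_eq fun _ => Bool.decide_eq_true.symm)).of_eq
      fun L => ?_
  -- The recursion also receives the whole list, which `h` ignores; it is decoupled from `L` so that
  -- the induction goes through.
  have : ∀ L' L : List α, (List.recOn L true fun b l IH => h L' (b, l, IH) : Bool) = true ↔
      L.Pairwise R := by
    intro L' L
    induction L with
    | nil => simp
    | cons a L ih => rw [List.pairwise_cons, ← ih]; simp [h]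
  exact this L L

/-- If the left cuts of the measures of rational intervals are uniformly c.e., then so are the left
cuts of the measures of `Σ⁰₁` sets. -/
theorem exists_indexesLeftCut {ν : FiniteMeasure ℝ}
    (hν : REPred fun x : ℕ × ℕ => ((rat x.2 : ℚ) : ℝ) < (ν : Measure ℝ).real (ratInterval x.1)) :
    ∃ g : Code → Code, Computable g ∧
      ∀ (U : Set ℝ) (e : Code), IndexesOpen e U → IndexesLeftCut (g e) (ν U : ℝ) := by
  -- Inclusion in U is replaced by halting of the program `e`, which makes the predicate meaningful,
  -- and r.e., for every program.
  have hA : REPred fun x : Code × ℕ × ℕ => (x.1.eval x.2.1).Dom ∧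
      ((rat x.2.2 : ℚ) : ℝ) < (ν : Measure ℝ).real (ratInterval x.2.1) :=
    rePred_and (Partrec.dom_re (Code.eval_part.comp Computable.fst
      (Computable.fst.comp Computable.snd))) (rePred_comp hν Computable.snd)
  have hdisj : PrimrecPred fun L : List (ℕ × ℕ) =>
      L.Pairwise fun x y => Disjoint (ratInterval x.1) (ratInterval y.1) := by
    refine primrecPred_pairwise ?_
    have h1 : Primrec fun x : (ℕ × ℕ) × ℕ × ℕ => x.1.1 := Primrec.fst.comp Primrec.fst
    have h2 : Primrec fun x : (ℕ × ℕ) × ℕ × ℕ => x.2.1 := Primrec.fst.comp Primrec.snd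
    exact ((primrecRel_rat_le.comp (primrec_rightEnd.comp h1) (primrec_leftEnd.comp h2)).or
      (primrecRel_rat_le.comp (primrec_rightEnd.comp h2) (primrec_leftEnd.comp h1))).of_eq
        fun x => (disjoint_ratInterval_iff _ _).symm
  have hlt : PrimrecPred fun x : ℕ × List (ℕ × ℕ) => rat x.1 < (x.2.map fun x => rat x.2).sum :=
    (primrecRel_rat_lt.comp Primrec.fst (primrec_ratSum.comp Primrec.snd)).of_eq
      fun x => by rw [rat_ratSum]
  have hB1 := rePred_comp (rePred_forall_mem_list (α := Code) (β := ℕ × ℕ)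
    (p := fun e y => (e.eval y.1).Dom ∧
      ((rat y.2 : ℚ) : ℝ) < (ν : Measure ℝ).real (ratInterval y.1)) hA)
    (f := fun x : (Code × ℕ) × List (ℕ × ℕ) => (x.1.1, x.2))
    ((Computable.fst.comp Computable.fst).pair Computable.snd)
  have hB2 := rePred_comp hdisj.computablePred.to_re
    (f := fun x : (Code × ℕ) × List (ℕ × ℕ) => x.2) Computable.snd
  have hB3 := rePred_comp hlt.computablePred.to_re
    (f := fun x : (Code × ℕ) × List (ℕ × ℕ) => (x.1.2, x.2))
    ((Computable.snd.comp Computable.fst).pair Computable.snd)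
  have hB := rePred_and hB1 (rePred_and hB2 hB3)
  let p : Code × ℕ → List (ℕ × ℕ) → Prop := fun x L =>
    (∀ y ∈ L, (x.1.eval y.1).Dom ∧
        ((rat y.2 : ℚ) : ℝ) < (ν : Measure ℝ).real (ratInterval y.1)) ∧
      (L.Pairwise fun x y => Disjoint (ratInterval x.1) (ratInterval y.1)) ∧
      rat x.2 < (L.map fun x => rat x.2).sum
  have hE := rePred_exists (p := p) hB
  obtain ⟨g, hg, hgi⟩ := exists_indexesCE (p := fun e n => ∃ L, p (e, n) L) hE
  refine ⟨g, hg, fun U e he n => ?_⟩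
  rw [← hgi e n]
  have hU : ((ν U : NNReal) : ℝ) = (ν : Measure ℝ).real U :=
    FiniteMeasure.measureReal_eq_coe_coeFn.symm
  simp only [Set.mem_ofPred_eq, hU, lt_measureReal_iff he.1, p, ← he.2 _]

/-- The search that semidecides `rat r < ν I`, where `x` is the pair of codes of `I` and `r`: the
witness `(j, s, m, t, u)` consists of a smaller interval `j` of measure greater than `rat u` for a
measure `μ k` that is close to `ν` on the tent function with parameters `I` and `s`. -/
theorem lt_measureReal_ratInterval_iff {μ : ℕ → FiniteMeasure ℝ} {ν : FiniteMeasure ℝ}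
    (hconv : ∀ x, Tendsto (fun n => ∫ y, ratTent x y ∂(μ n : Measure ℝ)) atTop
      (𝓝 (∫ y, ratTent x y ∂(ν : Measure ℝ))))
    {modulus : ℕ × ℕ → ℕ → ℕ}
    (hmod : ∀ x, IsModulus (modulus x) (fun n => ∫ y, ratTent x y ∂(μ n : Measure ℝ))
      (∫ y, ratTent x y ∂(ν : Measure ℝ))) (i r : ℕ) :
    ((rat r : ℚ) : ℝ) < (ν : Measure ℝ).real (ratInterval i) ↔
      ∃ w : ℕ × ℕ × ℕ × ℕ × ℕ, (IsNested w.1 i w.2.1 ∧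
        rat r + rat (ratFrac (w.2.1 + 1) w.2.2.1) ≤ rat w.2.2.2.2) ∧
        ((rat w.2.2.2.2 : ℚ) : ℝ) < (μ (modulus (i, w.2.1) w.2.2.1 + w.2.2.2.1) : Measure ℝ).real
          (ratInterval w.1) := by
  constructor
  · intro h
    obtain ⟨j, k, s, hji, hkj, hk⟩ := exists_isNested_lt (ν : Measure ℝ) i h
    obtain ⟨v, hv1, hv2⟩ := exists_rat_btwn hk
    obtain ⟨u, rfl⟩ := exists_rat_eq v
    have hs : (0 : ℝ) < 1 / ((s : ℝ) + 1) := by positivity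
    have hint : 1 / ((s : ℝ) + 1) * (rat u : ℝ) < ∫ y, ratTent (j, s) y ∂(ν : Measure ℝ) :=
      (mul_lt_mul_of_pos_left hv2 hs).trans_le
        (le_integral_ratTent _ (j, s) (measurableSet_ratInterval k) fun y hy => hkj.ratTent_eq hy)
    obtain ⟨N, hN⟩ := eventually_atTop.1 ((hconv (j, s)).eventually_const_lt hint)
    obtain ⟨m, hm⟩ : ∃ m : ℕ, ((s : ℚ) + 1) / ((m : ℚ) + 1) < rat u - rat r := by
      have hlim : Tendsto (fun m : ℕ => ((s : ℚ) + 1) * (1 / ((m : ℚ) + 1))) atTop (𝓝 0) := by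
        simpa using (tendsto_one_div_add_atTop_nhds_zero_nat (𝕜 := ℚ)).const_mul ((s : ℚ) + 1)
      have hpos : 0 < rat u - rat r := sub_pos.2 (Rat.cast_lt.1 hv1)
      obtain ⟨m, hm⟩ := (hlim.eventually_lt_const hpos).exists
      exact ⟨m, by rwa [mul_one_div] at hm⟩
    -- The offset `N` pushes the index beyond the modulus of the trapezoid on `i` and also into the
    -- range where the integrals over `j` are large; for the latter no modulus is needed.
    refine ⟨(j, s, m, N, u), ⟨hji, ?_⟩, ?_⟩
    · rw [rat_ratFrac]
      push_cast
      linarith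
    · have h1 := (hN _ (Nat.le_add_left N (modulus (i, s) m))).trans_le
        (integral_ratTent_le _ (j, s))
      exact lt_of_mul_lt_mul_left h1 hs.le
  · rintro ⟨⟨j, s, m, t, u⟩, ⟨hji, hru⟩, hu⟩
    simp only at hji hru hu
    set K := modulus (i, s) m + t with hK
    have hs : (0 : ℝ) < 1 / ((s : ℝ) + 1) := by positivity
    have h1 : 1 / ((s : ℝ) + 1) * (rat u : ℝ) < ∫ y, ratTent (i, s) y ∂(μ K : Measure ℝ) :=
      (mul_lt_mul_of_pos_left hu hs).trans_le
        (le_integral_ratTent _ (i, s) (measurableSet_ratInterval j) fun y hy => hji.ratTent_eq hy)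
    have h2 := (abs_lt.1 (hmod (i, s) m K (Nat.le_add_right _ _))).2
    have h3 := integral_ratTent_le (ν : Measure ℝ) (i, s)
    have h4 : ((1 : ℝ) / 2) ^ m ≤ 1 / ((m : ℝ) + 1) := by
      rw [div_pow, one_pow]
      have : (m : ℝ) + 1 ≤ 2 ^ m := by exact_mod_cast Nat.lt_two_pow_self
      exact one_div_le_one_div_of_le (by positivity) this
    have h5 : (rat r : ℝ) + ((s : ℝ) + 1) / ((m : ℝ) + 1) ≤ rat u := by
      rw [rat_ratFrac] at hru
      have := (Rat.cast_le (K := ℝ)).2 hru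
      push_cast at this
      exact this
    have h6 : 1 / ((s : ℝ) + 1) * (((s : ℝ) + 1) / ((m : ℝ) + 1)) = 1 / ((m : ℝ) + 1) := by
      field_simp
    have h7 := mul_le_mul_of_nonneg_left h5 hs.le
    rw [mul_add, h6] at h7
    -- Compare after scaling by the height: the slack (s+1)/(m+1) becomes 1/(m+1), which absorbs the
    -- convergence error below 2^{-m}.
    refine lt_of_mul_lt_mul_left (a := 1 / ((s : ℝ) + 1)) ?_ hs.le
    simp only at h3
    linarith

theorem primrecPred_isNested : PrimrecPred fun x : ℕ × ℕ × ℕ => IsNested x.1 x.2.1 x.2.2 := by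
  have h1 : Primrec fun x : ℕ × ℕ × ℕ => x.1 := Primrec.fst
  have h2 : Primrec fun x : ℕ × ℕ × ℕ => x.2.1 := Primrec.fst.comp Primrec.snd
  have h3 : Primrec fun x : ℕ × ℕ × ℕ => ratFrac 1 x.2.2 :=
    primrec₂_ratFrac.comp (Primrec.const 1) (Primrec.snd.comp Primrec.snd)
  exact ((primrecRel_rat_le.comp (primrec₂_ratAdd.comp (primrec_leftEnd.comp h2) h3)
    (primrec_leftEnd.comp h1)).and
    (primrecRel_rat_le.comp (primrec₂_ratAdd.comp (primrec_rightEnd.comp h1) h3)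
      (primrec_rightEnd.comp h2))).of_eq fun x => by simp only [rat_ratAdd, IsNested]

theorem rePred_lt_measureReal_ratInterval {μ : ℕ → FiniteMeasure ℝ} {ν : FiniteMeasure ℝ}
    (hμ : IsUniformlyComputable μ) (hconv : EffectivelyVaguelyConverges μ ν) :
    REPred fun x : ℕ × ℕ => ((rat x.2 : ℚ) : ℝ) < (ν : Measure ℝ).real (ratInterval x.1) := by
  obtain ⟨-, g, hg, hgU⟩ := hμ
  obtain ⟨hlim, G, hG, hGf⟩ := hconv
  obtain ⟨c, hc, hci⟩ := exists_indexesFunction_ratTent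
  obtain ⟨k, hk, hki⟩ := exists_indexesCompact_ratIcc
  obtain ⟨o, ho, hoi⟩ := exists_indexesOpen_ratInterval
  have hGd : ∀ x : ℕ × ℕ, ∃ d ∈ G (c x) (k x.1),
      IndexesModulus d (fun n => ∫ y, ratTent x y ∂(μ n : Measure ℝ))
        (∫ y, ratTent x y ∂(ν : Measure ℝ)) := fun x =>
    hGf _ (isCompactlySupportedComputable_ratTent x) _ _ (hci x)
      ((tsupport_ratTent x).symm ▸ hki x.1)
  choose d hd modulus hdm hmod using hGd
  choose e he hei using fun n j => hgU n _ _ (hoi j)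
  -- Semidecides the measure bound for a witness: obtain the modulus program, run it at the required
  -- precision, obtain a left-cut program for that measure and interval, and run it on `u`.
  let φ : ℕ × ℕ → ℕ × ℕ × ℕ × ℕ × ℕ →. ℕ := fun x w =>
    (G (c (x.1, w.2.1)) (k x.1)).bind fun d =>
      (d.eval w.2.2.1).bind fun M =>
        (g (M + w.2.2.2.1) (o w.1)).bind fun d' => d'.eval w.2.2.2.2
  have hφ : Partrec₂ φ := by
    have w : Computable fun x : (ℕ × ℕ) × ℕ × ℕ × ℕ × ℕ × ℕ => x.2 := Computable.snd
    have w1 := Computable.snd.comp w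
    have w2 := Computable.snd.comp w1
    have w3 := Computable.snd.comp w2
    have i : Computable fun x : (ℕ × ℕ) × ℕ × ℕ × ℕ × ℕ × ℕ => x.1.1 :=
      Computable.fst.comp Computable.fst
    refine Partrec.bind (hG.comp (hc.comp (i.pair (Computable.fst.comp w1))) (hk.comp i)) ?_
    refine Partrec.bind (Code.eval_part.comp Computable.snd
      ((Computable.fst.comp w2).comp Computable.fst)) ?_
    refine Partrec.bind (hg.comp (Primrec.nat_add.to_comp.comp Computable.snd
      (((Computable.fst.comp w3).comp Computable.fst).comp Computable.fst))
      (ho.comp (((Computable.fst.comp w).comp Computable.fst).comp Computable.fst))) ?_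
    exact Code.eval_part.comp Computable.snd ((((Computable.snd.comp w3).comp
      Computable.fst).comp Computable.fst).comp Computable.fst)
  have hφdom : ∀ x w, (φ x w).Dom ↔ ((rat w.2.2.2.2 : ℚ) : ℝ) <
      (μ (modulus (x.1, w.2.1) w.2.2.1 + w.2.2.2.1) : Measure ℝ).real (ratInterval w.1) := by
    intro x w
    have h1 : φ x w =
        (e (modulus (x.1, w.2.1) w.2.2.1 + w.2.2.2.1) w.1).eval w.2.2.2.2 := by
      simp only [φ]
      rw [Part.eq_some_iff.2 (hd (x.1, w.2.1)), Part.bind_some,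
        Part.eq_some_iff.2 (hdm (x.1, w.2.1) w.2.2.1), Part.bind_some, Encodable.encode_nat,
        Part.eq_some_iff.2 (he _ w.1), Part.bind_some]
    rw [h1, ← hei _ _ _]
    rfl
  have hnest : PrimrecPred fun x : (ℕ × ℕ) × ℕ × ℕ × ℕ × ℕ × ℕ =>
      IsNested x.2.1 x.1.1 x.2.2.1 ∧
        rat x.1.2 + rat (ratFrac (x.2.2.1 + 1) x.2.2.2.1) ≤ rat x.2.2.2.2.2 := by
    have w : Primrec fun x : (ℕ × ℕ) × ℕ × ℕ × ℕ × ℕ × ℕ => x.2 := Primrec.snd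
    have w1 := Primrec.snd.comp w
    have w2 := Primrec.snd.comp w1
    have w3 := Primrec.snd.comp w2
    have i : Primrec fun x : (ℕ × ℕ) × ℕ × ℕ × ℕ × ℕ × ℕ => x.1.1 :=
      Primrec.fst.comp Primrec.fst
    have hn : PrimrecPred fun x : (ℕ × ℕ) × ℕ × ℕ × ℕ × ℕ × ℕ => IsNested x.2.1 x.1.1 x.2.2.1 :=
      (primrecPred_isNested.comp ((Primrec.fst.comp w).pair (i.pair (Primrec.fst.comp w1))) :)
    refine hn.and ?_
    have r : Primrec fun x : (ℕ × ℕ) × ℕ × ℕ × ℕ × ℕ × ℕ => x.1.2 := Primrec.snd.comp Primrec.fst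
    have f : Primrec fun x : (ℕ × ℕ) × ℕ × ℕ × ℕ × ℕ × ℕ => ratFrac (x.2.2.1 + 1) x.2.2.2.1 :=
      primrec₂_ratFrac.comp (Primrec.succ.comp (Primrec.fst.comp w1)) (Primrec.fst.comp w2)
    refine (primrecRel_rat_le.comp (primrec₂_ratAdd.comp r f) (Primrec.snd.comp w3)).of_eq
      fun x => ?_
    rw [rat_ratAdd]
  refine (rePred_exists (p := fun (x : ℕ × ℕ) (w : ℕ × ℕ × ℕ × ℕ × ℕ) =>
    (IsNested w.1 x.1 w.2.1 ∧
        rat x.2 + rat (ratFrac (w.2.1 + 1) w.2.2.1) ≤ rat w.2.2.2.2) ∧ (φ x w).Dom)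
    (rePred_and hnest.computablePred.to_re (Partrec.dom_re hφ))).of_eq fun x => ?_
  rw [lt_measureReal_ratInterval_iff
    (fun y => hlim _ (isCompactlySupportedComputable_ratTent y)) hmod]
  simp only [hφdom]

end EffVague

theorem proposition5p2 (μ : ℕ → MeasureTheory.FiniteMeasure ℝ)
    (ν : MeasureTheory.FiniteMeasure ℝ)
    (hμ : EffVague.IsUniformlyComputable μ)
    (hconv : EffVague.EffectivelyVaguelyConverges μ ν)
    (hν : EffVague.IsComputableReal (ν Set.univ : ℝ)) :
    EffVague.IsComputableMeasure ν := by
  obtain ⟨g, hg, hgU⟩ := EffVague.exists_indexesLeftCut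
    (EffVague.rePred_lt_measureReal_ratInterval hμ hconv)
  exact ⟨hν, fun e => Part.some (g e), hg, fun U e he => ⟨g e, Part.mem_some _, hgU U e he⟩⟩
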